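/- For $n\ge 1$ let $Y=(Y_1,\dots,Y_n)$ be a vector of independent standard normal random variables, and call the line $\{tY: t\in\mathbb{R}\}\subset\mathbb{R}^n$ a random line. For a real number $r$, put a closed Euclidean $n$-ball of radius $r$ at each of the $2^n$ vertices $v\in\{-1,1\}^n$ of the cube $[-1,1]^n$ (for $r<0$ the balls are understood to be empty), and let $\alpha_n(r)$ be the probability that the random line intersects at least one of these balls. Let $(r_n)_{n\ge 1}$ be a sequence of real numbers. 1. If, for some constant $\alpha$ with $0\le\alpha<1-\frac{2}{\pi}$, $r_n\le\sqrt{\alpha n}$ for all $n\ge 1$, then $\alpha_n(r_n)\to 0$ as $n\to\infty$. 2. If, for some constant $\alpha>1-\frac{2}{\pi}$, $r_n\ge\sqrt{\alpha n}$ for all $n\ge 1$, then $\alpha_n(r_n)\to 1$ as $n\to\infty$. 3. If, for some $z\in\mathbb{R}$, $r_n=\sqrt{\left(1-\frac{2}{\pi}\right)n}+z\sqrt{\frac{2(\pi-3)}{\pi(\pi-2)}}$ for all $n\ge 1$, then $\alpha_n(r_n)\to\Phi(z)$ as $n\to\infty$, where $\Phi$ is the cumulative distribution function of the standard normal distribution.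 -/

import Mathlib

open Filter Topology MeasureTheory ProbabilityTheory

/-- The `2 ^ n` vertices of the cube `[-1,1]^n`. -/
def cubeVertices (n : ℕ) : Set (EuclideanSpace ℝ (Fin n)) :=
  {v | ∀ i, v i = -1 ∨ v i = 1}

/-- The line `{t y : t ∈ ℝ}` through the origin associated with the vector `y`. -/
def lineThrough {n : ℕ} (y : EuclideanSpace ℝ (Fin n)) : Set (EuclideanSpace ℝ (Fin n)) :=
  Set.range fun t : ℝ => t • y

/-- The set of vectors whose line meets at least one of the closed Euclidean balls of radius `r`
centred at the vertices of `[-1,1]^n`. -/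
def hitSet (n : ℕ) (r : ℝ) : Set (EuclideanSpace ℝ (Fin n)) :=
  {y | ∃ v ∈ cubeVertices n, (lineThrough y ∩ Metric.closedBall v r).Nonempty}

/-- The probability that the line of a random vector `Y = (Y₁, …, Yₙ)`, with independent standard
normal coordinates, meets at least one of the balls. -/
noncomputable def hitProb (n : ℕ) (r : ℝ) : ℝ :=
  (stdGaussian (EuclideanSpace ℝ (Fin n))).real (hitSet n r)

/-!
Write `S = ∑ |yᵢ|` and `Q = ∑ yᵢ²`. The vertex closest to the line of `y ≠ 0` has the signs of the
coordinates of `y`, and its squared distance to the line is `n - S² / Q`. So the line meets a ball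
of radius `r ≥ 0` exactly when `(n - r²) Q ≤ S²` (`mem_hitSet_iff`), and the problem is one about
sums of independent variables.

Put `a = √(2/π) = E|Y|`, `b² = 1 - a²`, and let `s` be the coefficient of `z` in the third claim.
At the radius `r = b √n + z s` the hitting condition, solved for its dominant linear part, says that
`n^(-1/2) ∑ (a² - 2 a |Yᵢ| + a² Yᵢ²) / (2 b s)` plus a remainder is at most `z`
(`hit_condition_iff`). The summands are centred, and the first four absolute moments of a Gaussian
give `E (a² - 2 a |Y| + a² Y²)² = 4 a² - 6 a⁴ = (2 b s)²`, so that the central limit theorem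
applies. Up to constants, the remainder consists of `(S - n a)² / n^(3/2)`, which tends to `0` in
`L¹` (`tendstoInMeasure_sq_centered_sum`), and of terms which vanish almost surely by the law of large
numbers for `Q`. Slutsky's theorem then yields the limit `Φ(z)` (`tendsto_hitProb_critical`).

The first two claims follow from the third: the hitting probability is monotone in the radius,
`√(α n)` is eventually below (respectively above) `b √n + z s` for every fixed `z`, and `Φ` tends to
`0` at `-∞` and to `1` at `+∞`.
-/

/-! ### Absolute moments of the standard Gaussian -/

lemma integral_abs_pow_gaussianReal (k : ℕ) :
    ∫ x, |x| ^ k ∂(gaussianReal 0 1) =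
      2 ^ ((k : ℝ) / 2) * Real.Gamma ((k + 1) / 2) / √Real.pi := by
  rw [integral_gaussianReal_eq_integral_smul one_ne_zero]
  have h1 : ∀ x : ℝ, gaussianPDFReal 0 1 x • |x| ^ k =
      (fun u : ℝ => (√(2 * Real.pi))⁻¹ * (u ^ (k : ℝ) * Real.exp (-(1 / 2) * u ^ (2 : ℝ)))) |x| := by
    intro x
    have : -x ^ 2 / 2 = -(1 / 2) * x ^ 2 := by ring
    simp [gaussianPDFReal, this]
    ring
  rw [integral_congr_ae (ae_of_all _ h1)]
  rw [integral_comp_abs (f := fun u : ℝ =>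
      (√(2 * Real.pi))⁻¹ * (u ^ (k : ℝ) * Real.exp (-(1 / 2) * u ^ (2 : ℝ)))), integral_const_mul,
    integral_rpow_mul_exp_neg_mul_rpow (by norm_num) (by linarith [k.cast_nonneg (α := ℝ)])
      (by norm_num)]
  have h2 : ((1 : ℝ) / 2) ^ (-((k : ℝ) + 1) / 2) = 2 ^ ((k : ℝ) / 2) * √2 := by
    rw [one_div, Real.inv_rpow (by norm_num), ← Real.rpow_neg (by norm_num), Real.sqrt_eq_rpow,
      ← Real.rpow_add (by norm_num)]
    congr 1
    ring
  rw [h2, Real.sqrt_mul (by norm_num)]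
  have := Real.sqrt_pos.2 Real.pi_pos
  field_simp

lemma integrable_abs_pow_gaussianReal (k : ℕ) :
    Integrable (fun x : ℝ => |x| ^ k) (gaussianReal 0 1) := by
  have := (memLp_id_gaussianReal (μ := 0) (v := 1) k).integrable_norm_pow'
  simpa using this

lemma integral_abs_gaussianReal : ∫ x, |x| ∂(gaussianReal 0 1) = √(2 / Real.pi) := by
  have := integral_abs_pow_gaussianReal 1
  norm_num [← Real.sqrt_eq_rpow] at this
  simpa using this

lemma integral_sq_gaussianReal : ∫ x, x ^ 2 ∂(gaussianReal 0 1) = 1 := by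
  have := integral_abs_pow_gaussianReal 2
  have h : Real.Gamma (3 / 2) = √Real.pi / 2 := by
    rw [show (3 / 2 : ℝ) = 1 / 2 + 1 by norm_num, Real.Gamma_add_one (by norm_num),
      Real.Gamma_one_half_eq]
    ring
  have hp := Real.sqrt_pos.2 Real.pi_pos
  norm_num [h] at this
  rw [this]
  field_simp

lemma integral_abs_pow_three_gaussianReal :
    ∫ x, |x| ^ 3 ∂(gaussianReal 0 1) = 2 * √(2 / Real.pi) := by
  have := integral_abs_pow_gaussianReal 3
  have h : (2 : ℝ) ^ ((3 : ℝ) / 2) = 2 * √2 := by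
    rw [show (3 / 2 : ℝ) = 1 + 1 / 2 by norm_num, Real.rpow_add (by norm_num), Real.sqrt_eq_rpow,
      Real.rpow_one]
  norm_num [h] at this
  rw [this]
  norm_num
  ring

lemma integral_pow_four_gaussianReal : ∫ x, x ^ 4 ∂(gaussianReal 0 1) = 3 := by
  have := integral_abs_pow_gaussianReal 4
  have h : Real.Gamma (5 / 2) = 3 * √Real.pi / 4 := by
    rw [show (5 / 2 : ℝ) = 1 / 2 + 1 + 1 by norm_num, Real.Gamma_add_one (by norm_num),
      Real.Gamma_add_one (by norm_num), Real.Gamma_one_half_eq]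
    ring
  have hp := Real.sqrt_pos.2 Real.pi_pos
  have hx : ∀ x : ℝ, |x| ^ 4 = x ^ 4 := fun x => by
    rw [show 4 = 2 * 2 by norm_num, pow_mul, sq_abs, ← pow_mul]
  norm_num [h, hx] at this
  rw [this]
  field_simp

/-! ### The hitting condition in terms of the coordinates -/

/-- The condition says that the squared distance `n - S² / Q` from the nearest vertex to the line is
at most `r²`. The vector `y = 0` is excluded because its line is a single point. -/
lemma mem_hitSet_iff {n : ℕ} {r : ℝ} (hr : 0 ≤ r) {y : EuclideanSpace ℝ (Fin n)} (hy : y ≠ 0) :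
    y ∈ hitSet n r ↔ (n - r ^ 2) * ∑ i, y i ^ 2 ≤ (∑ i, |y i|) ^ 2 := by
  have hQ : 0 < ‖y‖ ^ 2 := by positivity
  rw [← EuclideanSpace.real_norm_sq_eq]
  -- the squared distance from a point of the line to a vertex
  have key : ∀ v ∈ cubeVertices n, ∀ t : ℝ,
      ‖t • y - v‖ ^ 2 = t ^ 2 * ‖y‖ ^ 2 - 2 * t * ∑ i, y i * v i + n := by
    intro v hv t
    have h1 : ∀ i, v i ^ 2 = 1 := fun i => by rcases hv i with h | h <;> simp [h]
    rw [EuclideanSpace.real_norm_sq_eq, EuclideanSpace.real_norm_sq_eq]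
    simp only [PiLp.sub_apply, PiLp.smul_apply, smul_eq_mul, sub_sq, h1, Finset.sum_add_distrib,
      Finset.sum_sub_distrib, Finset.mul_sum]
    simp [mul_pow, mul_assoc]
  constructor
  · rintro ⟨v, hv, _, ⟨t, rfl⟩, ht⟩
    rw [Metric.mem_closedBall, dist_eq_norm] at ht
    have h2 : ‖t • y - v‖ ^ 2 ≤ r ^ 2 := by gcongr
    rw [key v hv] at h2
    have h3 : |∑ i, y i * v i| ≤ ∑ i, |y i| := by
      refine (Finset.abs_sum_le_sum_abs _ _).trans_eq (Finset.sum_congr rfl fun i _ => ?_)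
      rcases hv i with h | h <;> simp [h]
    have h4 := sq_le_sq' (abs_le.1 h3).1 (abs_le.1 h3).2
    -- multiplying by `‖y‖²` completes the square in `t`
    have h5 := mul_le_mul_of_nonneg_right h2 hQ.le
    nlinarith [sq_nonneg (t * ‖y‖ ^ 2 - ∑ i, y i * v i)]
  · intro h
    -- the nearest vertex has the signs of the coordinates of `y`
    let v : EuclideanSpace ℝ (Fin n) := WithLp.toLp 2 fun i => if y i < 0 then -1 else 1
    have hv : v ∈ cubeVertices n := fun i => by
      by_cases hi : y i < 0 <;> simp [v, hi]
    have hs : ∑ i, y i * v i = ∑ i, |y i| := by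
      refine Finset.sum_congr rfl fun i _ => ?_
      by_cases hi : y i < 0
      · simp [v, hi, abs_of_neg hi]
      · simp [v, hi, abs_of_nonneg (not_lt.1 hi)]
    refine ⟨v, hv, _, ⟨(∑ i, |y i|) / ‖y‖ ^ 2, rfl⟩, ?_⟩
    rw [Metric.mem_closedBall, dist_eq_norm]
    refine le_of_sq_le_sq ?_ hr
    dsimp only
    rw [key v hv, hs]
    have : ((∑ i, |y i|) / ‖y‖ ^ 2) ^ 2 * ‖y‖ ^ 2 -
        2 * ((∑ i, |y i|) / ‖y‖ ^ 2) * ∑ i, |y i| + n = n - (∑ i, |y i|) ^ 2 / ‖y‖ ^ 2 := by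
      field_simp
      ring
    rw [this, sub_le_comm, le_div_iff₀ hQ]
    exact h

lemma hitSet_mono (n : ℕ) : Monotone (hitSet n) := fun _ _ h _ ⟨v, hv, hne⟩ =>
  ⟨v, hv, hne.mono (Set.inter_subset_inter_right _ (Metric.closedBall_subset_closedBall h))⟩

lemma hitProb_mono (n : ℕ) : Monotone (hitProb n) := fun _ _ h =>
  measureReal_mono (hitSet_mono n h)

/-- Realizes all the dimensions on one probability space, with the coordinates taken from a single
independent sequence. -/
lemma hitProb_eq_measureReal {Ω : Type*} {mΩ : MeasurableSpace Ω} {P : Measure Ω}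
    [IsProbabilityMeasure P] {Y : ℕ → Ω → ℝ} (hm : ∀ i, Measurable (Y i))
    (hY : ∀ i, HasLaw (Y i) (gaussianReal 0 1) P) (hind : iIndepFun Y P)
    {n : ℕ} (hn : 1 ≤ n) {r : ℝ} (hr : 0 ≤ r) :
    hitProb n r = P.real {ω | (n - r ^ 2) * ∑ i ∈ Finset.range n, Y i ω ^ 2 ≤
      (∑ i ∈ Finset.range n, |Y i ω|) ^ 2} := by
  have hlaw : HasLaw (fun ω => WithLp.toLp 2 fun i : Fin n => Y i ω)
      (stdGaussian (EuclideanSpace ℝ (Fin n))) P := by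
    have h := (hind.precomp Fin.val_injective).hasLaw_pi (fun i : Fin n => hY i)
    refine ⟨by fun_prop, ?_⟩
    rw [← map_pi_eq_stdGaussian, ← h.map_eq, Measure.map_map (by fun_prop) (by fun_prop)]
    rfl
  have hne : ∀ᵐ y ∂(stdGaussian (EuclideanSpace ℝ (Fin n))), y ≠ 0 := by
    have h0 : ∀ᵐ x ∂(gaussianReal 0 1), x ≠ 0 := by
      have := nullSingletonClass_gaussianReal (μ := 0) (v := 1) one_ne_zero
      exact compl_mem_ae_iff.2 (measure_singleton 0)
    rw [← hlaw.ae_iff (by fun_prop)]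
    filter_upwards [((hY 0).ae_iff (by fun_prop)).2 h0] with ω hω h
    exact hω (congrArg (fun y : EuclideanSpace ℝ (Fin n) => y ⟨0, hn⟩) h)
  have hae : hitSet n r =ᵐ[stdGaussian (EuclideanSpace ℝ (Fin n))]
      {y | (n - r ^ 2) * ∑ i, y i ^ 2 ≤ (∑ i, |y i|) ^ 2} := by
    filter_upwards [hne] with y hy
    exact propext (mem_hitSet_iff hr hy)
  rw [hitProb, measureReal_congr hae, ← hlaw.measureReal_eq]
  · simp [Finset.sum_range]
  · exact measurableSet_le (by fun_prop) (by fun_prop)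

/-- With `S = ∑ |yᵢ|` and `Q = ∑ yᵢ²`, the condition that the line of `y` meets a ball of radius
`r = b m + c s`, where `m = √n`, solved for the linear statistic `∑ (a² - 2 a |yᵢ| + a² yᵢ²)`. -/
lemma hit_condition_iff {a b s c m S Q : ℝ} (hab : a ^ 2 + b ^ 2 = 1) (hb : 0 < b) (hs : 0 < s)
    (hm : 0 < m) :
    (m ^ 2 - (b * m + c * s) ^ 2) * Q ≤ S ^ 2 ↔
      m⁻¹ * ((m ^ 2 * a ^ 2 - 2 * a * S + a ^ 2 * Q) / (2 * b * s)) +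
        -(2 * b * s)⁻¹ * ((S - m ^ 2 * a) ^ 2 / m ^ 3) +
        -((2 * b * s)⁻¹ * (2 * b * (c * s) * (Q / m ^ 2 - 1) + (c * s) ^ 2 * (Q / m ^ 2) * m⁻¹))
        ≤ c := by
  have hb2 : b ^ 2 = 1 - a ^ 2 := by linarith
  rw [← sub_nonneg, ← sub_nonneg (a := c)]
  have h : c - (m⁻¹ * ((m ^ 2 * a ^ 2 - 2 * a * S + a ^ 2 * Q) / (2 * b * s)) +
        -(2 * b * s)⁻¹ * ((S - m ^ 2 * a) ^ 2 / m ^ 3) +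
        -((2 * b * s)⁻¹ * (2 * b * (c * s) * (Q / m ^ 2 - 1) +
          (c * s) ^ 2 * (Q / m ^ 2) * m⁻¹))) =
      (S ^ 2 - (m ^ 2 * a ^ 2 - 2 * b * (c * s) * m - (c * s) ^ 2) * Q) / (2 * b * s * m ^ 3) := by
    field_simp
    ring
  have h2 : S ^ 2 - (m ^ 2 - (b * m + c * s) ^ 2) * Q =
      S ^ 2 - (m ^ 2 * a ^ 2 - 2 * b * (c * s) * m - (c * s) ^ 2) * Q := by
    linear_combination (-m ^ 2 * Q + 2 * m ^ 2 * Q) * hb2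
  rw [h, h2, le_div_iff₀ (by positivity), zero_mul]

/-! ### Limit theorems for sums of random variables -/

/-- Convergence in distribution implies pointwise convergence of the distribution functions
when the limit law has no atoms. -/
lemma tendsto_measureReal_le_of_tendstoInDistribution {Ω Ω' : Type*} {mΩ : MeasurableSpace Ω}
    {mΩ' : MeasurableSpace Ω'} {P : Measure Ω} {P' : Measure Ω'} [IsProbabilityMeasure P]
    [IsProbabilityMeasure P'] {X : ℕ → Ω → ℝ} {Z : Ω' → ℝ} {μ : Measure ℝ}
    [IsProbabilityMeasure μ] [NullSingletonClass μ]
    (h : TendstoInDistribution X atTop Z (fun _ => P) P') (hZ : HasLaw Z μ P') (z : ℝ) :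
    Tendsto (fun n => P.real {ω | X n ω ≤ z}) atTop (𝓝 (cdf μ z)) := by
  have key := ProbabilityMeasure.tendsto_measure_of_null_frontier_of_tendsto' h.tendsto
    (E := Set.Iic z) (by simp [hZ.map_eq])
  have key2 := (ENNReal.tendsto_toReal (by simp [hZ.map_eq])).comp key
  rw [cdf_eq_real, measureReal_def]
  convert! key2 using 2 with n
  · simp [measureReal_def, Measure.map_apply_of_aemeasurable (h.forall_aemeasurable n)
      measurableSet_Iic]
    rfl
  · simp [hZ.map_eq]

/-- For a sequence of independent identically distributed square integrable variables, the
centred sum is `o(n ^ (3/4))` in probability. -/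
lemma tendstoInMeasure_sq_centered_sum {Ω : Type*} {mΩ : MeasurableSpace Ω} {P : Measure Ω}
    [IsProbabilityMeasure P] {X : ℕ → Ω → ℝ} (hX : MemLp (X 0) 2 P) (hind : iIndepFun X P)
    (hid : ∀ i, IdentDistrib (X i) (X 0) P P) :
    TendstoInMeasure P (fun (n : ℕ) ω =>
      (∑ i ∈ Finset.range n, X i ω - n * P[X 0]) ^ 2 / √n ^ 3) atTop (fun _ => 0) := by
  have hL (i : ℕ) : MemLp (X i) 2 P := (hid i).memLp_iff.2 hX
  have hS (n : ℕ) : MemLp (fun ω => ∑ i ∈ Finset.range n, X i ω) 2 P :=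
    memLp_finsetSum _ fun i _ => hL i
  have hmean (n : ℕ) : ∫ ω, ∑ i ∈ Finset.range n, X i ω ∂P = n * P[X 0] := by
    rw [integral_finsetSum _ fun i _ => (hL i).integrable (by norm_num)]
    simp [(hid _).integral_eq]
  have hvar (n : ℕ) : ∫ ω, (∑ i ∈ Finset.range n, X i ω - n * P[X 0]) ^ 2 ∂P =
      n * Var[X 0; P] := by
    rw [← hmean n, ← variance_eq_integral (hS n).aemeasurable]
    have := IndepFun.variance_sum (μ := P) (X := X) (s := Finset.range n) (fun i _ => hL i)
      (fun i _ j _ hij => hind.indepFun hij)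
    rw [Finset.sum_fn] at this
    rw [this]
    simp [(hid _).variance_eq]
  have hD (n : ℕ) : MemLp (fun ω => ∑ i ∈ Finset.range n, X i ω - n * P[X 0]) 2 P :=
    (hS n).sub (memLp_const _)
  refine tendstoInMeasure_of_tendsto_eLpNorm one_ne_zero
    (fun n => ((hD n).integrable_sq.div_const _).aestronglyMeasurable)
    aestronglyMeasurable_const ?_
  refine Tendsto.congr (f₁ := fun n : ℕ => ENNReal.ofReal (Var[X 0; P] * (√n)⁻¹))
    (fun n => ?_) ?_
  · change _ = eLpNorm (_ - 0) 1 P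
    rw [sub_zero, eLpNorm_one_eq_lintegral_enorm, ← ofReal_integral_norm_eq_lintegral_enorm
      ((hD n).integrable_sq.div_const _)]
    congr 1
    have hnorm (ω : Ω) : ‖(∑ i ∈ Finset.range n, X i ω - n * P[X 0]) ^ 2 / √n ^ 3‖ =
        (∑ i ∈ Finset.range n, X i ω - n * P[X 0]) ^ 2 / √n ^ 3 :=
      Real.norm_of_nonneg (by positivity)
    simp_rw [hnorm]
    rw [integral_div, hvar]
    rcases n.eq_zero_or_pos with rfl | hn
    · simp
    · have h1 : 0 < √(n : ℝ) := Real.sqrt_pos.2 (by exact_mod_cast hn)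
      have h2 := Real.sq_sqrt (n.cast_nonneg (α := ℝ))
      field_simp
      rw [h2]
  · have := (tendsto_inv_atTop_zero.comp
      (Real.tendsto_sqrt_atTop.comp tendsto_natCast_atTop_atTop)).const_mul Var[X 0; P]
    rw [mul_zero] at this
    simpa only [ENNReal.ofReal_zero] using! (ENNReal.continuous_ofReal.tendsto 0).comp this

/-! ### The normalized linear statistic -/

lemma integral_sub_abs_add_sq_gaussianReal (a : ℝ) (ha : a = √(2 / Real.pi)) :
    ∫ x, (a ^ 2 - 2 * a * |x| + a ^ 2 * x ^ 2) ∂(gaussianReal 0 1) = 0 := by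
  have i1 : Integrable (fun x : ℝ => |x|) (gaussianReal 0 1) := by
    simpa using integrable_abs_pow_gaussianReal 1
  have i2 : Integrable (fun x : ℝ => x ^ 2) (gaussianReal 0 1) := by
    simpa using integrable_abs_pow_gaussianReal 2
  rw [integral_add (by fun_prop) (by fun_prop), integral_sub (by fun_prop) (by fun_prop),
    integral_const_mul, integral_const_mul, integral_abs_gaussianReal, integral_sq_gaussianReal,
    ← ha]
  simp
  ring

lemma integral_sq_sub_abs_add_sq_gaussianReal (a : ℝ) (ha : a = √(2 / Real.pi)) :
    ∫ x, (a ^ 2 - 2 * a * |x| + a ^ 2 * x ^ 2) ^ 2 ∂(gaussianReal 0 1) =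
      4 * a ^ 2 - 6 * a ^ 4 := by
  have i1 : Integrable (fun x : ℝ => |x|) (gaussianReal 0 1) := by
    simpa using integrable_abs_pow_gaussianReal 1
  have i2 : Integrable (fun x : ℝ => x ^ 2) (gaussianReal 0 1) := by
    simpa using integrable_abs_pow_gaussianReal 2
  have i3 : Integrable (fun x : ℝ => |x| ^ 3) (gaussianReal 0 1) :=
    integrable_abs_pow_gaussianReal 3
  have i4 : Integrable (fun x : ℝ => x ^ 4) (gaussianReal 0 1) := by
    simpa [show ∀ x : ℝ, |x| ^ 4 = x ^ 4 from fun x => Even.pow_abs ⟨2, rfl⟩ x] using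
      integrable_abs_pow_gaussianReal 4
  have h (x : ℝ) : (a ^ 2 - 2 * a * |x| + a ^ 2 * x ^ 2) ^ 2 =
      a ^ 4 - 4 * a ^ 3 * |x| + (4 * a ^ 2 + 2 * a ^ 4) * x ^ 2 - 4 * a ^ 3 * |x| ^ 3
        + a ^ 4 * x ^ 4 := by
    rw [show x ^ 4 = (x ^ 2) ^ 2 by ring, ← sq_abs x]
    ring
  simp_rw [h]
  rw [integral_add (by fun_prop) (by fun_prop), integral_sub (by fun_prop) (by fun_prop),
    integral_add (by fun_prop) (by fun_prop), integral_sub (by fun_prop) (by fun_prop)]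
  simp only [integral_const_mul, integral_abs_gaussianReal, integral_sq_gaussianReal,
    integral_abs_pow_three_gaussianReal, integral_pow_four_gaussianReal, ← ha]
  simp
  ring

/-! ### Hitting probabilities -/

/-- The distributional limit at the critical radius. -/
theorem tendsto_hitProb_critical (z : ℝ) :
    Tendsto (fun n : ℕ => hitProb n (√((1 - 2 / Real.pi) * n) +
      z * √(2 * (Real.pi - 3) / (Real.pi * (Real.pi - 2))))) atTop
      (𝓝 (cdf (gaussianReal 0 1) z)) := by
  obtain ⟨Ω, mΩ, P, Y, hm, hY, hind, hP⟩ := exists_iid ℕ (gaussianReal 0 1)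
  obtain ⟨Ω', mΩ', P', Z, -, hZ⟩ := (gaussianReal 0 1).exists_hasLaw
  have hP' : IsProbabilityMeasure P' := hZ.isProbabilityMeasure
  have hpi := Real.pi_gt_three
  set a := √(2 / Real.pi) with ha
  set b := √(1 - 2 / Real.pi)
  set s := √(2 * (Real.pi - 3) / (Real.pi * (Real.pi - 2)))
  have ha2 : a ^ 2 = 2 / Real.pi := Real.sq_sqrt (by positivity)
  have hb1 : 0 < 1 - 2 / Real.pi := by
    rw [sub_pos, div_lt_one (by positivity)]; linarith
  have hs1 : 0 < 2 * (Real.pi - 3) / (Real.pi * (Real.pi - 2)) :=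
    div_pos (by linarith) (mul_pos (by linarith) (by linarith))
  have hb2 : b ^ 2 = 1 - 2 / Real.pi := Real.sq_sqrt hb1.le
  have hs2 : s ^ 2 = 2 * (Real.pi - 3) / (Real.pi * (Real.pi - 2)) := Real.sq_sqrt hs1.le
  have hb : 0 < b := Real.sqrt_pos.2 hb1
  have hs : 0 < s := Real.sqrt_pos.2 hs1
  have hab : a ^ 2 + b ^ 2 = 1 := by rw [ha2, hb2]; ring
  have hident {g : ℝ → ℝ} (hg : Measurable g) (i : ℕ) :
      IdentDistrib (fun ω => g (Y i ω)) (fun ω => g (Y 0 ω)) P P :=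
    IdentDistrib.comp ⟨(hm i).aemeasurable, (hm 0).aemeasurable, by
      rw [(hY i).map_eq, (hY 0).map_eq]⟩ hg
  have hint {g : ℝ → ℝ} (hg : Measurable g) :
      ∫ ω, g (Y 0 ω) ∂P = ∫ x, g x ∂(gaussianReal 0 1) :=
    (hY 0).integral_comp hg.aestronglyMeasurable
  -- the central limit theorem for the normalized linear statistic
  have hT : TendstoInDistribution (fun (n : ℕ) ω => (√n)⁻¹ * ∑ i ∈ Finset.range n,
      (a ^ 2 - 2 * a * |Y i ω| + a ^ 2 * Y i ω ^ 2) / (2 * b * s)) atTop Z (fun _ => P) P' := by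
    let g : ℝ → ℝ := fun x => (a ^ 2 - 2 * a * |x| + a ^ 2 * x ^ 2) / (2 * b * s)
    have hg : Measurable g := by fun_prop
    refine tendstoInDistribution_inv_sqrt_mul_sum (X := fun i ω => g (Y i ω)) hZ ?_ ?_
      (hind.comp (fun _ => g) fun _ => hg) (hident hg)
    · rw [hint hg, integral_div, integral_sub_abs_add_sq_gaussianReal a ha, zero_div]
    · change ∫ ω, g (Y 0 ω) ^ 2 ∂P = 1
      rw [hint (g := fun x => g x ^ 2) (by fun_prop)]
      simp only [g, div_pow]
      rw [integral_div, integral_sq_sub_abs_add_sq_gaussianReal a ha,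
        div_eq_one_iff_eq (by positivity), mul_pow, mul_pow, hb2, hs2,
        show a ^ 4 = (a ^ 2) ^ 2 by ring, ha2]
      have : Real.pi - 2 ≠ 0 := by linarith
      field_simp
      ring
  -- the quadratic remainder
  have hE1 : TendstoInMeasure P (fun (n : ℕ) ω =>
      (∑ i ∈ Finset.range n, |Y i ω| - n * a) ^ 2 / √n ^ 3) atTop (fun _ => 0) := by
    have hL : MemLp (fun ω => |Y 0 ω|) 2 P := by
      have h := (memLp_id_gaussianReal (μ := 0) (v := 1) 2).norm
      rw [← (hY 0).map_eq] at h
      exact h.comp_of_map (hm 0).aemeasurable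
    have := tendstoInMeasure_sq_centered_sum hL (hind.comp (fun _ x => |x|) (by fun_prop))
      (hident (g := fun x => |x|) (by fun_prop))
    have hmean : ∫ ω, |Y 0 ω| ∂P = a :=
      (hint (g := fun x => |x|) (by fun_prop)).trans integral_abs_gaussianReal
    simpa only [Function.comp_def, hmean] using this
  -- the law of large numbers for the squared norm
  have hQ : ∀ᵐ ω ∂P, Tendsto (fun n : ℕ => (∑ i ∈ Finset.range n, Y i ω ^ 2) / n) atTop
      (𝓝 1) := by
    have hi : Integrable (fun ω => Y 0 ω ^ 2) P := by
      have h : Integrable (fun x : ℝ => x ^ 2) (gaussianReal 0 1) := by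
        simpa using integrable_abs_pow_gaussianReal 2
      rw [← (hY 0).map_eq] at h
      exact h.comp_aemeasurable (hm 0).aemeasurable
    have := strong_law_ae_real (fun i ω => Y i ω ^ 2) hi
      (fun i j hij => (hind.comp (fun _ x => x ^ 2) (by fun_prop)).indepFun hij)
      (hident (g := fun x => x ^ 2) (by fun_prop))
    rwa [hint (g := fun x => x ^ 2) (by fun_prop), integral_sq_gaussianReal] at this
  have hsqrt : Tendsto (fun n : ℕ => √(n : ℝ)) atTop atTop :=
    Real.tendsto_sqrt_atTop.comp tendsto_natCast_atTop_atTop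
  have hE2 : TendstoInMeasure P (fun (n : ℕ) ω => -((2 * b * s)⁻¹ *
      (2 * b * (z * s) * ((∑ i ∈ Finset.range n, Y i ω ^ 2) / n - 1) +
        (z * s) ^ 2 * ((∑ i ∈ Finset.range n, Y i ω ^ 2) / n) * (√n)⁻¹))) atTop
      (fun _ => 0) := by
    refine tendstoInMeasure_of_tendsto_ae
      (fun n => Measurable.aestronglyMeasurable (by fun_prop)) ?_
    filter_upwards [hQ] with ω hω
    have := ((((hω.sub_const 1).const_mul (2 * b * (z * s))).add ((hω.const_mul ((z * s) ^ 2)).mul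
      (tendsto_inv_atTop_zero.comp hsqrt))).const_mul (2 * b * s)⁻¹).neg
    simpa using! this
  -- Slutsky's theorem
  have hlaw : TendstoInDistribution (fun (n : ℕ) ω => (√n)⁻¹ * ∑ i ∈ Finset.range n,
      (a ^ 2 - 2 * a * |Y i ω| + a ^ 2 * Y i ω ^ 2) / (2 * b * s) +
      -(2 * b * s)⁻¹ * ((∑ i ∈ Finset.range n, |Y i ω| - n * a) ^ 2 / √n ^ 3) +
      -((2 * b * s)⁻¹ *
        (2 * b * (z * s) * ((∑ i ∈ Finset.range n, Y i ω ^ 2) / n - 1) +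
          (z * s) ^ 2 * ((∑ i ∈ Finset.range n, Y i ω ^ 2) / n) * (√n)⁻¹))) atTop Z
      (fun _ => P) P' := by
    have h1 := hT.continuous_comp_prodMk_of_tendstoInMeasure_const
      (g := fun p : ℝ × ℝ => p.1 + -(2 * b * s)⁻¹ * p.2) (by fun_prop) hE1
      (fun n => Measurable.aemeasurable (by fun_prop))
    simpa using! h1.add_of_tendstoInMeasure_const hE2
      (fun n => Measurable.aemeasurable (by fun_prop))
  have hnull := nullSingletonClass_gaussianReal (μ := 0) (v := 1) one_ne_zero
  have hlim := tendsto_measureReal_le_of_tendstoInDistribution hlaw hZ z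
  refine hlim.congr' ?_
  -- a negative radius, possible only for small `n`, is excluded by `-(z * s) / b ≤ √n`
  filter_upwards [eventually_ge_atTop 1, hsqrt.eventually_ge_atTop (-(z * s) / b)] with n hn hr
  have hm0 : 0 < √(n : ℝ) := Real.sqrt_pos.2 (by exact_mod_cast hn)
  have hmn := Real.sq_sqrt (n.cast_nonneg (α := ℝ))
  have hr0 : 0 ≤ b * √n + z * s := by
    rw [div_le_iff₀ hb] at hr
    linarith
  rw [Real.sqrt_mul hb1.le, hitProb_eq_measureReal hm hY hind hn hr0]
  congr 1
  ext ω
  have := hit_condition_iff (c := z) (S := ∑ i ∈ Finset.range n, |Y i ω|)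
    (Q := ∑ i ∈ Finset.range n, Y i ω ^ 2) hab hb hs hm0
  rw [hmn] at this
  change _ ↔ (n - (b * √n + z * s) ^ 2) * ∑ i ∈ Finset.range n, Y i ω ^ 2 ≤ _
  rw [this, Set.mem_ofPred_eq, ← Finset.sum_div]
  simp only [Finset.sum_add_distrib, Finset.sum_sub_distrib, Finset.mul_sum, Finset.sum_const,
    Finset.card_range, nsmul_eq_mul]

theorem mainTheorem1 :
    (∀ (r : ℕ → ℝ) (α : ℝ), 0 ≤ α → α < 1 - 2 / Real.pi →
      (∀ n : ℕ, 1 ≤ n → r n ≤ √(α * n)) →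
      Tendsto (fun n : ℕ => hitProb n (r n)) atTop (𝓝 0)) ∧
    (∀ (r : ℕ → ℝ) (α : ℝ), 1 - 2 / Real.pi < α →
      (∀ n : ℕ, 1 ≤ n → √(α * n) ≤ r n) →
      Tendsto (fun n : ℕ => hitProb n (r n)) atTop (𝓝 1)) ∧
    (∀ (r : ℕ → ℝ) (z : ℝ),
      (∀ n : ℕ, 1 ≤ n → r n = √((1 - 2 / Real.pi) * n) +
        z * √(2 * (Real.pi - 3) / (Real.pi * (Real.pi - 2)))) →
      Tendsto (fun n : ℕ => hitProb n (r n)) atTop (𝓝 (cdf (gaussianReal 0 1) z))) := by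
  have hb1 : 0 ≤ 1 - 2 / Real.pi := by
    rw [sub_nonneg, div_le_one Real.pi_pos]
    exact Real.two_le_pi
  have hsqrt : Tendsto (fun n : ℕ => √(n : ℝ)) atTop atTop :=
    Real.tendsto_sqrt_atTop.comp tendsto_natCast_atTop_atTop
  refine ⟨fun r α hα hα' hr => ?_, fun r α hα hr => ?_, fun r z hr => ?_⟩
  · refine tendsto_order.2 ⟨fun x hx => Eventually.of_forall fun n =>
      hx.trans_le measureReal_nonneg, fun x hx => ?_⟩
    -- compare with the critical radius for `z` so negative that `Φ(z) < x`
    obtain ⟨z, hz⟩ := ((tendsto_cdf_atBot (gaussianReal 0 1)).eventually_lt_const hx).exists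
    have hgap := hsqrt.const_mul_atTop (sub_pos.2 (Real.sqrt_lt_sqrt hα hα'))
    filter_upwards [(tendsto_hitProb_critical z).eventually_lt_const hz, eventually_ge_atTop 1,
      hgap.eventually_ge_atTop (-(z * √(2 * (Real.pi - 3) / (Real.pi * (Real.pi - 2)))))]
      with n h1 hn h2
    refine (hitProb_mono n ((hr n hn).trans ?_)).trans_lt h1
    rw [Real.sqrt_mul hα, Real.sqrt_mul hb1]
    linarith
  · refine tendsto_order.2 ⟨fun x hx => ?_, fun x hx => Eventually.of_forall fun n =>
      measureReal_le_one.trans_lt hx⟩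
    -- compare with the critical radius for `z` so large that `x < Φ(z)`
    obtain ⟨z, hz⟩ := ((tendsto_cdf_atTop (gaussianReal 0 1)).eventually_const_lt hx).exists
    have hgap := hsqrt.const_mul_atTop (sub_pos.2 (Real.sqrt_lt_sqrt hb1 hα))
    filter_upwards [(tendsto_hitProb_critical z).eventually_const_lt hz, eventually_ge_atTop 1,
      hgap.eventually_ge_atTop (z * √(2 * (Real.pi - 3) / (Real.pi * (Real.pi - 2))))]
      with n h1 hn h2
    refine h1.trans_le (hitProb_mono n (le_trans ?_ (hr n hn)))
    rw [Real.sqrt_mul (hb1.trans hα.le), Real.sqrt_mul hb1]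
    linarith
  · refine (tendsto_hitProb_critical z).congr' ?_
    filter_upwards [eventually_ge_atTop 1] with n hn
    rw [hr n hn]
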